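/- Let $\Omega\subset\mathbb R^d$ be a bounded Lipschitz domain and let $\gamma$ be a finite positive Borel (Radon) measure on $\Omega$. Let $\mathfrak M(\Omega;\mathbb R^d)$ be the space of finite $\mathbb R^d$-valued Radon measures on $\Omega$. For such a measure $g$ let $|g|$ be its variation measure (with respect to the Euclidean norm) and $\|g\|_{\mathfrak M}=|g|(\Omega)$ its Radon norm; for finite signed measures the same notation is used with norm $\|\cdot\|_{\mathcal M}$. Write $|g|\le\gamma$ if $|g|(E)\le\gamma(E)$ for every Borel set $E\subseteq\Omega$. For $u\in L^1(\Omega)$ let $Du$ be its distributional gradient, and put $$\mathrm{TV}_{\mathrm{pwL}}^{\gamma}(u):=\inf\{\,\|Du-g\|_{\mathfrak M} : g\in\mathfrak M(\Omega;\mathbb R^d),\ |g|\le\gamma\,\}\in[0,\infty].$$ As usual, the norms $\|Du-g\|_{\mathfrak M}$ and $\|(|Du|-\gamma)_+\|_{\mathcal M}$ are understood to be $+\infty$ if $Du$ is not a finite $\mathbb R^d$-valued Radon measure, that is, if $u\notin BV(\Omega)$. Then for every $u\in L^1(\Omega)$ the infimum is attained, and $$\mathrm{TV}_{\mathrm{pwL}}^{\gamma}(u)=\big\|(|Du|-\gamma)_+\big\|_{\mathcal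 M},$$ where $(\cdot)_+$ denotes the positive part of a signed measure in the sense of the Hahn decomposition. -/

import Mathlib

open MeasureTheory TopologicalSpace
open scoped ENNReal NNReal Distributions Gradient

noncomputable section

namespace TVpwL

/-- `Ω` is, near each of its boundary points and up to a rigid motion, the strict epigraph of a
Lipschitz function of `d - 1` variables (here: of a function on the hyperplane orthogonal to the
unit vector `e`). -/
def HasLipschitzBoundary {d : ℕ} (Ω : Set (EuclideanSpace ℝ (Fin d))) : Prop :=
  ∀ x ∈ frontier Ω, ∃ e : EuclideanSpace ℝ (Fin d), ‖e‖ = 1 ∧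
    ∃ (K : ℝ≥0) (f : (ℝ ∙ e)ᗮ → ℝ) (r : ℝ), LipschitzWith K f ∧ 0 < r ∧
      ∀ y ∈ Metric.ball x r, (y ∈ Ω ↔ f ((ℝ ∙ e)ᗮ.orthogonalProjectionOnto y) < inner ℝ e y)

/-- A bounded Lipschitz domain of `ℝ^d`: a nonempty connected bounded open set with Lipschitz
boundary (openness is carried by the type `Opens`). -/
structure IsBoundedLipschitzDomain {d : ℕ} (Ω : Opens (EuclideanSpace ℝ (Fin d))) : Prop where
  isConnected : IsConnected (Ω : Set (EuclideanSpace ℝ (Fin d)))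
  isBounded : Bornology.IsBounded (Ω : Set (EuclideanSpace ℝ (Fin d)))
  hasLipschitzBoundary : HasLipschitzBoundary (Ω : Set (EuclideanSpace ℝ (Fin d)))

/-- An `ℝ^d`-valued measure has finite variation, so that its variation measure may be regarded as
a signed measure. -/
instance isFiniteMeasure_variation {X : Type*} [MeasurableSpace X] {d : ℕ}
    (μ : VectorMeasure X (EuclideanSpace ℝ (Fin d))) : IsFiniteMeasure μ.variation := by
  let c : Fin d → SignedMeasure X := fun i =>
    μ.mapRange (EuclideanSpace.proj (𝕜 := ℝ) i : EuclideanSpace ℝ (Fin d) →L[ℝ] ℝ).toLinearMap.toAddMonoidHom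
      (EuclideanSpace.proj (𝕜 := ℝ) i : EuclideanSpace ℝ (Fin d) →L[ℝ] ℝ).continuous
  have hfin : IsFiniteMeasure (∑ i, (c i).totalVariation) := by
    refine ⟨?_⟩
    rw [Measure.finsetSum_apply]
    refine ENNReal.sum_lt_top.2 fun i _ => ?_
    simp only [SignedMeasure.totalVariation]
    exact measure_lt_top _ _
  refine isFiniteMeasure_of_le (∑ i, (c i).totalVariation)
    (VectorMeasure.variation_le_of_forall_enorm_le fun s _ => ?_)
  rw [Measure.finsetSum_apply]
  calc ‖μ s‖ₑ ≤ ∑ i, ‖c i s‖ₑ := by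
        have h : μ s = ∑ i, EuclideanSpace.single i (c i s) := by
          ext j
          simp [c, Finset.sum_apply]
          rfl
        calc ‖μ s‖ₑ = ‖∑ i, EuclideanSpace.single i (c i s)‖ₑ := by rw [← h]
          _ ≤ ∑ i, ‖EuclideanSpace.single i (c i s)‖ₑ := enorm_sum_le _ _
          _ = ∑ i, ‖c i s‖ₑ := by simp [enorm_eq_nnnorm]
    _ ≤ ∑ i, (c i).totalVariation s :=
        Finset.sum_le_sum fun i _ => SignedMeasure.enorm_le_totalVariation _ _

/-- The Radon norm `‖μ‖_𝓜 = |μ|(X)` of a finite vector-valued (or signed) measure. -/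
def radonNorm {X : Type*} [MeasurableSpace X] {V : Type*} [NormedAddCommGroup V]
    (μ : VectorMeasure X V) : ℝ≥0∞ :=
  μ.variation Set.univ

/-- The positive part of a signed measure in its Hahn (Jordan) decomposition. -/
def posPart {X : Type*} [MeasurableSpace X] (μ : SignedMeasure X) : SignedMeasure X :=
  μ.toJordanDecomposition.posPart.toSignedMeasure

/-- The `d`-dimensional Lebesgue measure on `Ω`. -/
abbrev lebesgue {d : ℕ} (Ω : Opens (EuclideanSpace ℝ (Fin d))) : Measure Ω :=
  (volume : Measure (EuclideanSpace ℝ (Fin d))).comap Subtype.val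

/-- The finite `ℝ^d`-valued Borel measure `μ` on `Ω` is the distributional gradient of `u`:
`∫_Ω u ∇φ dx = -∫_Ω φ dμ` for all test functions `φ ∈ C_c^∞(Ω)`. -/
def IsWeakGradient {d : ℕ} (Ω : Opens (EuclideanSpace ℝ (Fin d)))
    (u : Lp ℝ 1 (lebesgue Ω)) (μ : VectorMeasure Ω (EuclideanSpace ℝ (Fin d))) : Prop :=
  ∀ φ : 𝓓(Ω, ℝ), ∫ x : Ω, u x • ∇ φ (x : EuclideanSpace ℝ (Fin d)) ∂(lebesgue Ω) =
    -∫ᵛ x : Ω, φ x ∂•μ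

/-- A vector measure that annihilates all test functions vanishes. -/
theorem eq_zero_of_integral_testFunction {d : ℕ} {Ω : Opens (EuclideanSpace ℝ (Fin d))}
    {σ : VectorMeasure Ω (EuclideanSpace ℝ (Fin d))}
    (h : ∀ φ : 𝓓(Ω, ℝ), ∫ᵛ x : Ω, φ x ∂•σ = 0) : σ = 0 := by
  have hopen : ∀ V : Set Ω, IsOpen V → σ V = 0 := by
    intro V hV
    have hV' : IsOpen (Subtype.val '' V) := Ω.isOpen.isOpenMap_subtype_val V hV
    obtain ⟨f, hf_supp, hf_diff, hf_range⟩ := hV'.exists_contDiff_support_eq (n := ⊤)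
    let g : ℕ → EuclideanSpace ℝ (Fin d) → ℝ := fun n x =>
      Real.smoothTransition (n * f x - 1) * Real.smoothTransition (n - ‖x‖ ^ 2)
    have hg_supp : ∀ n, tsupport (g n) ⊆ {x | 1 ≤ n * f x} ∩ {x | ‖x‖ ^ 2 ≤ n} := by
      intro n
      refine closure_minimal (fun x hx => ?_) ?_
      · have hx' : g n x ≠ 0 := hx
        refine ⟨?_, ?_⟩
        · by_contra hcon
          simp only [Set.mem_ofPred_eq, not_le] at hcon
          exact hx' (by simp [g, Real.smoothTransition.zero_of_nonpos (x := n * f x - 1)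
            (by linarith)])
        · by_contra hcon
          simp only [Set.mem_ofPred_eq, not_le] at hcon
          exact hx' (by simp [g, Real.smoothTransition.zero_of_nonpos (x := n - ‖x‖ ^ 2)
            (by linarith)])
      · exact (isClosed_le continuous_const (continuous_const.mul hf_diff.continuous)).inter
          (isClosed_le (by fun_prop) continuous_const)
    let φ : ℕ → 𝓓(Ω, ℝ) := fun n =>
      { toFun := g n
        contDiff' := by
          refine ContDiff.mul (Real.smoothTransition.contDiff.comp ?_)
            (Real.smoothTransition.contDiff.comp ?_)
          · exact (contDiff_const.mul hf_diff).sub contDiff_const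
          · exact contDiff_const.sub (contDiff_norm_sq ℝ)
        hasCompactSupport' := by
          refine (isCompact_closedBall (0 : EuclideanSpace ℝ (Fin d)) (n + 1)).of_isClosed_subset
            (isClosed_tsupport _) (fun x hx => ?_)
          have h2 : ‖x‖ ^ 2 ≤ n := (hg_supp n hx).2
          rw [mem_closedBall_zero_iff]
          nlinarith [norm_nonneg x]
        tsupport_subset' := by
          intro x hx
          have h1 : 1 ≤ n * f x := (hg_supp n hx).1
          have h2 : x ∈ Function.support f := by
            intro h0
            rw [h0] at h1
            norm_num at h1
          rw [hf_supp] at h2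
          obtain ⟨y, -, rfl⟩ := h2
          exact y.2 }
    have hφ : ∀ n x, φ n x = g n x := fun n x => rfl
    have hlim : Filter.Tendsto (fun n => ∫ᵛ x : Ω, φ n x ∂•σ) Filter.atTop
        (nhds (∫ᵛ x : Ω, V.indicator (fun _ => (1 : ℝ)) x ∂•σ)) := by
      refine VectorMeasure.tendsto_integral_filter_of_norm_le_const ?_ ⟨1, ?_⟩ ?_
      · exact Filter.Eventually.of_forall fun n =>
          ((φ n).continuous.comp continuous_subtype_val).aestronglyMeasurable
      · refine Filter.Eventually.of_forall fun n => Filter.Eventually.of_forall fun x => ?_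
        rw [hφ, Real.norm_eq_abs, abs_of_nonneg (mul_nonneg (Real.smoothTransition.nonneg _)
          (Real.smoothTransition.nonneg _))]
        exact mul_le_one₀ (Real.smoothTransition.le_one _) (Real.smoothTransition.nonneg _)
          (Real.smoothTransition.le_one _)
      · refine Filter.Eventually.of_forall fun x => ?_
        by_cases hx : x ∈ V
        · rw [Set.indicator_of_mem hx]
          have hfx : 0 < f x := by
            have h1 : (x : EuclideanSpace ℝ (Fin d)) ∈ Function.support f := by
              rw [hf_supp]
              exact ⟨x, hx, rfl⟩
            exact lt_of_le_of_ne (hf_range ⟨x, rfl⟩).1 (Ne.symm h1)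
          refine tendsto_const_nhds.congr' ?_
          obtain ⟨N, hN⟩ := exists_nat_ge (2 / f x)
          obtain ⟨M, hM⟩ := exists_nat_ge (‖(x : EuclideanSpace ℝ (Fin d))‖ ^ 2 + 1)
          filter_upwards [Filter.eventually_ge_atTop N, Filter.eventually_ge_atTop M] with n h1 h2
          have h1' : (N : ℝ) ≤ n := by exact_mod_cast h1
          have h2' : (M : ℝ) ≤ n := by exact_mod_cast h2
          have h3 : 2 ≤ n * f x := (div_le_iff₀ hfx).1 (hN.trans h1')
          rw [hφ]
          simp only [g]
          rw [Real.smoothTransition.one_of_one_le (by linarith),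
            Real.smoothTransition.one_of_one_le (by linarith), one_mul]
        · rw [Set.indicator_of_notMem hx]
          have hfx : f x = 0 := by
            by_contra h0
            have h1 : (x : EuclideanSpace ℝ (Fin d)) ∈ Function.support f := h0
            rw [hf_supp] at h1
            obtain ⟨y, hy, hyx⟩ := h1
            exact hx (Subtype.ext hyx ▸ hy)
          refine tendsto_const_nhds.congr fun n => ?_
          rw [hφ]
          simp only [g, hfx]
          rw [Real.smoothTransition.zero_of_nonpos (by norm_num), zero_mul]
    simp only [h] at hlim
    have h0 := tendsto_nhds_unique hlim tendsto_const_nhds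
    rw [VectorMeasure.integral_indicator_const _ hV.measurableSet] at h0
    simpa using h0
  refine VectorMeasure.ext fun s hs => ?_
  rw [_root_.zero_apply]
  refine MeasurableSpace.induction_on_inter (C := fun s _ => σ s = 0)
    (BorelSpace.measurable_eq (α := Ω)) isPiSystem_isOpen (by simp) (fun t ht => hopen t ht)
    ?_ ?_ s hs
  · intro t ht h0
    have := VectorMeasure.of_add_of_sdiff (v := σ) ht MeasurableSet.univ (Set.subset_univ t)
    rw [h0, hopen _ isOpen_univ, zero_add, ← Set.compl_eq_univ_sdiff] at this
    exact this
  · intro t hd ht h0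
    rw [VectorMeasure.of_disjoint_iUnion ht hd]
    simp [h0]

/-- The distributional gradient of `u` is unique if it exists as a finite measure. -/
theorem IsWeakGradient.unique {d : ℕ} {Ω : Opens (EuclideanSpace ℝ (Fin d))}
    {u : Lp ℝ 1 (lebesgue Ω)} {μ ν : VectorMeasure Ω (EuclideanSpace ℝ (Fin d))}
    (hμ : IsWeakGradient Ω u μ) (hν : IsWeakGradient Ω u ν) : μ = ν := by
  refine sub_eq_zero.1 (eq_zero_of_integral_testFunction fun φ => ?_)
  have hint : ∀ ρ : VectorMeasure Ω (EuclideanSpace ℝ (Fin d)),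
      ρ.Integrable (fun x : Ω => φ x) := by
    intro ρ
    obtain ⟨C, hC⟩ := φ.continuous.bounded_above_of_compact_support φ.hasCompactSupport
    exact Integrable.of_bound (φ.continuous.comp continuous_subtype_val).aestronglyMeasurable C
      (Filter.Eventually.of_forall fun x => hC x)
  rw [VectorMeasure.integral_sub_vectorMeasure (hint μ) (hint ν), sub_eq_zero]
  exact neg_injective ((hμ φ).symm.trans (hν φ))

/-- `u ∈ BV(Ω)`: the distributional gradient of `u` is a finite `ℝ^d`-valued measure. -/
def IsBV {d : ℕ} (Ω : Opens (EuclideanSpace ℝ (Fin d))) (u : Lp ℝ 1 (lebesgue Ω)) : Prop :=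
  ∃ μ, IsWeakGradient Ω u μ

open Classical in
/-- The distributional gradient `Du` as a finite `ℝ^d`-valued measure; only meaningful for
`u ∈ BV(Ω)` (otherwise the dummy value `0`). -/
def weakGradient {d : ℕ} (Ω : Opens (EuclideanSpace ℝ (Fin d)))
    (u : Lp ℝ 1 (lebesgue Ω)) : VectorMeasure Ω (EuclideanSpace ℝ (Fin d)) :=
  if h : IsBV Ω u then h.choose else 0

open Classical in
/-- `‖Du - g‖_𝓜`, with the convention that it is `∞` if `u ∉ BV(Ω)`. -/
def gradientDist {d : ℕ} (Ω : Opens (EuclideanSpace ℝ (Fin d)))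
    (u : Lp ℝ 1 (lebesgue Ω)) (g : VectorMeasure Ω (EuclideanSpace ℝ (Fin d))) : ℝ≥0∞ :=
  if IsBV Ω u then radonNorm (weakGradient Ω u - g) else ∞

/-- `TV_pwL^γ(u)`: the infimum of `‖Du - g‖_𝓜` over the `g ∈ 𝓜(Ω; ℝ^d)` with `|g| ≤ γ`. -/
def tvPwL {d : ℕ} (Ω : Opens (EuclideanSpace ℝ (Fin d))) (γ : Measure Ω)
    (u : Lp ℝ 1 (lebesgue Ω)) : ℝ≥0∞ :=
  ⨅ (g : VectorMeasure Ω (EuclideanSpace ℝ (Fin d))) (_ : g.variation ≤ γ), gradientDist Ω u g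

open Classical in
/-- `‖(|Du| - γ)_+‖_𝓜`, with the convention that it is `∞` if `u ∉ BV(Ω)`. -/
def excessNorm {d : ℕ} (Ω : Opens (EuclideanSpace ℝ (Fin d))) (γ : Measure Ω) [IsFiniteMeasure γ]
    (u : Lp ℝ 1 (lebesgue Ω)) : ℝ≥0∞ :=
  if IsBV Ω u then
    radonNorm (posPart ((weakGradient Ω u).variation.toSignedMeasure - γ.toSignedMeasure))
  else ∞

end TVpwL

end

/-! Write `ν = |Du|` and let `ν - γ` be the truncated difference of measures, the least `τ` with `ν
≤ τ + γ`; for finite measures it is the Hahn positive part. If `|g| ≤ γ`, then `ν ≤ |Du - g| + γ`,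
so `ν - γ ≤ |Du - g|`. Conversely, `α = ν - (ν - γ)` is the minimum of `ν` and `γ`. Scaling `Du` by
`h = dα/dν`, which lies in `[0, 1]`, gives `g = h Du` with `|g| ≤ α ≤ γ` and `|Du - g| ≤ (1 - h)ν =
ν - α ≤ ν - γ`. This `g` is a minimizer. No polar decomposition of `Du` is needed, only upper bounds
on variations. -/

namespace TVpwL

section VectorMeasure

variable {X F : Type*} {mX : MeasurableSpace X} [NormedAddCommGroup F] [NormedSpace ℝ F]

/-- The variation of `f μ` is at most `|f| |μ|`. -/
theorem variation_withDensity_lsmul_le (μ : VectorMeasure X F) (f : X → ℝ) :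
    (μ.withDensity f (ContinuousLinearMap.lsmul ℝ ℝ)).variation ≤
      μ.variation.withDensity fun x => ‖f x‖ₑ := by
  by_cases hf : μ.Integrable f
  · refine VectorMeasure.variation_le_of_forall_enorm_le fun s hs => ?_
    rw [VectorMeasure.withDensity_apply hf, withDensity_apply _ hs]
    refine VectorMeasure.enorm_setIntegral_le_lintegral_enorm.trans ?_
    have hB : ‖(ContinuousLinearMap.lsmul ℝ ℝ : ℝ →L[ℝ] F →L[ℝ] F)‖ₑ ≤ 1 := by
      rw [← ofReal_norm, ← ENNReal.ofReal_one]
      exact ENNReal.ofReal_le_ofReal ContinuousLinearMap.opNorm_lsmul_le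
    exact (mul_le_mul_left hB _).trans_eq (one_mul _)
  -- Without integrability `VectorMeasure.withDensity` is zero by default.
  · simp [VectorMeasure.withDensity, hf, Measure.zero_le]

/-- Removing the part of density `h` from `μ` leaves the part of density `1 - h`. -/
theorem sub_withDensity_lsmul [CompleteSpace F] (μ : VectorMeasure X F)
    [IsFiniteMeasure μ.variation] {h : X → ℝ} (hh : μ.Integrable h) :
    μ - μ.withDensity h (ContinuousLinearMap.lsmul ℝ ℝ) =
      μ.withDensity (fun x => 1 - h x) (ContinuousLinearMap.lsmul ℝ ℝ) := by
  have h1 : μ.Integrable fun _ => (1 : ℝ) := integrable_const (μ := μ.variation) 1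
  have h1h : μ.Integrable fun x => 1 - h x := Integrable.sub (μ := μ.variation) h1 hh
  ext s hs
  rw [_root_.sub_apply, VectorMeasure.withDensity_apply hh, VectorMeasure.withDensity_apply h1h,
    VectorMeasure.integral_fun_sub h1.restrict hh.restrict, VectorMeasure.setIntegral_const]
  simp

/-- A vector measure splits along any measure dominated by its variation. -/
theorem exists_variation_le_and_variation_sub_le [CompleteSpace F] (μ : VectorMeasure X F)
    [IsFiniteMeasure μ.variation] {α : Measure X} (hα : α ≤ μ.variation) :
    ∃ g : VectorMeasure X F, g.variation ≤ α ∧ (μ - g).variation ≤ μ.variation - α := by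
  set ν := μ.variation with hν
  have : IsFiniteMeasure α := isFiniteMeasure_of_le ν hα
  set h : X → ℝ := fun x => (α.rnDeriv ν x).toReal with hh
  have hle : ∀ᵐ x ∂ν, α.rnDeriv ν x ≤ 1 := Measure.rnDeriv_le_one_of_le hα
  have hint : μ.Integrable h := Measure.integrable_toReal_rnDeriv
  have hα' : ν.withDensity (fun x => ‖h x‖ₑ) = α := by
    refine Eq.trans (withDensity_congr_ae (hle.mono fun x hx => ?_))
      (Measure.withDensity_rnDeriv_eq α ν (Measure.absolutelyContinuous_of_le hα))
    simp only [hh]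
    rw [Real.enorm_of_nonneg ENNReal.toReal_nonneg,
      ENNReal.ofReal_toReal (ne_top_of_le_ne_top ENNReal.one_ne_top hx)]
  have hmeas : Measurable h := (Measure.measurable_rnDeriv α ν).ennreal_toReal
  -- Since `0 ≤ h ≤ 1` almost everywhere, the absolute values of `h` and `1 - h` add up to `1`.
  -- Cancelling the finite measure `α` then identifies `(1 - h)ν` with `ν - α`.
  have hadd : ν.withDensity (fun x => ‖1 - h x‖ₑ) + α = ν := by
    refine (congrArg (_ + ·) hα'.symm).trans ?_
    rw [← withDensity_add_left (by fun_prop)]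
    refine Eq.trans (withDensity_congr_ae (hle.mono fun x hx => ?_)) withDensity_one
    have h0 : 0 ≤ h x := ENNReal.toReal_nonneg
    have h1 : h x ≤ 1 := ENNReal.toReal_le_of_le_ofReal zero_le_one (by simpa using hx)
    rw [Pi.add_apply, Real.enorm_of_nonneg h0, Real.enorm_of_nonneg (sub_nonneg.2 h1),
      ← ENNReal.ofReal_add (sub_nonneg.2 h1) h0]
    simp
  refine ⟨μ.withDensity h (ContinuousLinearMap.lsmul ℝ ℝ),
    (variation_withDensity_lsmul_le μ h).trans_eq hα', ?_⟩
  rw [sub_withDensity_lsmul μ hint]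
  refine (variation_withDensity_lsmul_le μ _).trans_eq ?_
  rw [← hν]
  exact Measure.add_sub_cancel.symm.trans (congrArg (· - α) hadd)

end VectorMeasure

/-- A finite measure is at most its excess over another one plus that other measure. -/
theorem le_sub_add {X : Type*} {mX : MeasurableSpace X} (μ ν : Measure X) [IsFiniteMeasure μ]
    [IsFiniteMeasure ν] : μ ≤ (μ - ν) + ν := by
  -- The Jordan decomposition of the signed difference, rearranged so that both sides are positive
  -- measures.
  have h := Measure.sub_toSignedMeasure_eq_toSignedMeasure_sub (μ := μ) (ν := ν)
  have h' : μ + (ν - μ) = (μ - ν) + ν := by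
    rw [← Measure.toSignedMeasure_eq_toSignedMeasure_iff, Measure.toSignedMeasure_add,
      Measure.toSignedMeasure_add]
    rw [sub_eq_sub_iff_add_eq_add] at h
    exact h
  exact h' ▸ Measure.le_add_right le_rfl

theorem excessNorm_of_isBV {d : ℕ} {Ω : Opens (EuclideanSpace ℝ (Fin d))} (γ : Measure Ω)
    [IsFiniteMeasure γ] {u : Lp ℝ 1 (lebesgue Ω)} (hu : IsBV Ω u) :
    excessNorm Ω γ u = ((weakGradient Ω u).variation - γ) Set.univ := by
  -- A positive measure is its own variation, and the Jordan positive part is the truncated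
  -- difference.
  rw [excessNorm, if_pos hu, radonNorm, posPart, Measure.variation_toSignedMeasure,
    Measure.toJordanDecomposition_toSignedMeasure_sub,
    Measure.jordanDecompositionOfToSignedMeasureSub_posPart]

/-- The triangle inequality for variations and the minimality of the truncated difference. -/
theorem excessNorm_le_gradientDist {d : ℕ} {Ω : Opens (EuclideanSpace ℝ (Fin d))} {γ : Measure Ω}
    [IsFiniteMeasure γ] (u : Lp ℝ 1 (lebesgue Ω))
    {g : VectorMeasure Ω (EuclideanSpace ℝ (Fin d))} (hg : g.variation ≤ γ) :
    excessNorm Ω γ u ≤ gradientDist Ω u g := by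
  by_cases hu : IsBV Ω u
  · rw [excessNorm_of_isBV γ hu, gradientDist, if_pos hu]
    refine Measure.sub_le_of_le_add ?_ Set.univ
    calc (weakGradient Ω u).variation = (weakGradient Ω u - g + g).variation := by
          rw [sub_add_cancel]
      _ ≤ (weakGradient Ω u - g).variation + g.variation := VectorMeasure.variation_add_le
      _ ≤ (weakGradient Ω u - g).variation + γ := add_le_add_right hg _
  · rw [gradientDist, if_neg hu]
    exact le_top

theorem exists_gradientDist_le_excessNorm {d : ℕ} (Ω : Opens (EuclideanSpace ℝ (Fin d)))
    (γ : Measure Ω) [IsFiniteMeasure γ] (u : Lp ℝ 1 (lebesgue Ω)) :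
    ∃ g : VectorMeasure Ω (EuclideanSpace ℝ (Fin d)),
      g.variation ≤ γ ∧ gradientDist Ω u g ≤ excessNorm Ω γ u := by
  by_cases hu : IsBV Ω u
  · set ν := (weakGradient Ω u).variation with hν
    have hfin : IsFiniteMeasure (ν - γ) := isFiniteMeasure_of_le ν Measure.sub_le
    -- `ν - (ν - γ)` is the minimum of `ν` and `γ`, the largest part of `ν` that `γ` can absorb.
    obtain ⟨g, hg, hg'⟩ := exists_variation_le_and_variation_sub_le (weakGradient Ω u)
      (α := ν - (ν - γ)) Measure.sub_le
    refine ⟨g, hg.trans (Measure.sub_le_of_le_add ?_), ?_⟩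
    · rw [add_comm]
      exact le_sub_add ν γ
    · rw [gradientDist, if_pos hu, excessNorm_of_isBV γ hu, ← hν]
      refine (hg'.trans (Measure.sub_le_of_le_add ?_)) Set.univ
      rw [← hν, add_comm, Measure.sub_add_cancel_of_le Measure.sub_le]
  -- Outside `BV` the excess is `∞`, so any admissible `g` serves.
  · refine ⟨0, by rw [VectorMeasure.variation_zero]; exact Measure.zero_le _, ?_⟩
    rw [excessNorm, if_neg hu]
    exact le_top

end TVpwL

theorem mainTheorem2 {d : ℕ} (Ω : Opens (EuclideanSpace ℝ (Fin d)))
    (hΩ : TVpwL.IsBoundedLipschitzDomain Ω) (γ : Measure Ω) [IsFiniteMeasure γ]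
    (u : Lp ℝ 1 (TVpwL.lebesgue Ω)) :
    TVpwL.tvPwL Ω γ u = TVpwL.excessNorm Ω γ u ∧
      ∃ g : VectorMeasure Ω (EuclideanSpace ℝ (Fin d)),
        g.variation ≤ γ ∧ TVpwL.gradientDist Ω u g = TVpwL.tvPwL Ω γ u := by
  obtain ⟨g, hg, hle⟩ := TVpwL.exists_gradientDist_le_excessNorm Ω γ u
  have heq : TVpwL.tvPwL Ω γ u = TVpwL.excessNorm Ω γ u :=
    le_antisymm ((iInf₂_le g hg).trans hle)
      (le_iInf₂ fun _ h => TVpwL.excessNorm_le_gradientDist u h)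
  exact ⟨heq, g, hg, le_antisymm (hle.trans_eq heq.symm) (iInf₂_le g hg)⟩
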